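/- Let $\mathcal H$ be a nonzero complex Hilbert space and let $T$ be a bounded linear operator on $\mathcal H$ with modulus $|T|=(T^*T)^{1/2}$. Suppose that $T$ is quasinormal, that is, $T|T|=|T|T$, and pure, that is, there is no nonzero closed subspace $\mathcal M$ reducing $T$ (invariant under $T$ and $T^*$) such that $T|_{\mathcal M}$ is normal. Let $\sigma_{ext}(T)$ be the set of all $\lambda\in\mathbb C$ for which there is a nonzero bounded operator $X$ on $\mathcal H$ with $TX=\lambda XT$, let $\sigma_p(|T|)$ be the set of eigenvalues of $|T|$, and put $m_{|T|}=\inf\{\langle |T|x,x\rangle : \|x\|=1\}$. 1. If $m_{|T|}$ and $\|T\|$ both belong to $\sigma_p(|T|)$, then $\sigma_{ext}(T)=\{\lambda\in\mathbb C : |\lambda|\ge m_{|T|}/\|T\|\}$, the complement of the open disk of radius $m_{|T|}/\|T\|$ centered at $0$. 2. If $m_{|T|}$ and $\|T\|$ do not both belong to $\sigma_p(|T|)$, then $\sigma_{ext}(T)=\{\lambda\in\mathbb C : |\lambda|> m_{|T|}/\|T\|\}$, the complement of the closed disk of radius $m_{|T|}/\|T\|$ centered at $0$. -/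

import Mathlib

namespace ExtendedSpectrum

variable {H : Type*} [NormedAddCommGroup H] [InnerProductSpace ℂ H]

/-- The set of extended eigenvalues of `T`: the complex numbers `μ` for which there is a nonzero
bounded operator `X` with `T X = μ X T`. -/
def extSpectrum (T : H →L[ℂ] H) : Set ℂ :=
  {μ : ℂ | ∃ X : H →L[ℂ] H, X ≠ 0 ∧ T * X = μ • (X * T)}

/-- The point spectrum (set of eigenvalues) of `T`. -/
def pointSpectrum (T : H →L[ℂ] H) : Set ℂ :=
  {μ : ℂ | Module.End.HasEigenvalue (T : Module.End ℂ H) μ}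

/-- `m_T = inf {⟨T x, x⟩ : ‖x‖ = 1}`. For self-adjoint `T` the numbers `⟨T x, x⟩` are real;
`T.reApplyInnerSelf x` is the real part of `⟨T x, x⟩`. -/
noncomputable def lowerBd (T : H →L[ℂ] H) : ℝ :=
  sInf (T.reApplyInnerSelf '' {x : H | ‖x‖ = 1})

variable [CompleteSpace H]

/-- `T` is quasinormal: it commutes with its modulus `|T| = (T* T)^{1/2}`. -/
def IsQuasinormal (T : H →L[ℂ] H) : Prop :=
  T * CFC.abs T = CFC.abs T * T

/-- `M` reduces `T`: it is a closed subspace invariant under `T` and under its adjoint. -/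
structure Reduces (T : H →L[ℂ] H) (M : Submodule ℂ H) : Prop where
  isClosed : IsClosed (M : Set H)
  map_mem : ∀ x ∈ M, T x ∈ M
  adjoint_map_mem : ∀ x ∈ M, ContinuousLinearMap.adjoint T x ∈ M

/-- `T` is pure: there is no nonzero reducing subspace on which `T` restricts to a normal
operator. -/
def IsPure (T : H →L[ℂ] H) : Prop :=
  ∀ (M : Submodule ℂ H) (hM : Reduces T M), M ≠ ⊥ →
    haveI : CompleteSpace M := hM.isClosed.completeSpace_coe
    ¬ IsStarNormal (T.restrict (p := M) (q := M) hM.map_mem)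

end ExtendedSpectrum

/-! Write `A = |T|` and `m = lowerBd A`. Quasinormality lets `T*` annihilate the self-commutator of
`T`, so purity puts a nonzero vector of `ker T*` into every nonzero subspace that reduces `T`, in
particular into the spectral subspaces of `A`. Take such a vector `u` where `A ≤ a` and such a
vector `v` where `A ≥ b > 0`. The orbit `T ^ n u` and the backward orbit `w n` of `v` under `T*` are
orthogonal, with `‖T ^ n u‖ ≤ a ^ n ‖u‖` and `‖w n‖ ≤ b⁻¹ ^ n ‖v‖`, so for `a / b ≤ ‖μ‖` the series
`X x = ∑ μ⁻¹ ^ n ⟪w n, x⟫ T ^ n u` converges and satisfies `T X = μ X T`.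

Conversely, `T X = μ X T` gives `m ^ n ‖X x‖ ≤ ‖T ^ n X x‖ ≤ ‖μ‖ ^ n ‖X‖ ‖T ^ n x‖`, while
`‖T ^ n x‖ ≤ ‖T‖ ^ n ‖x‖`, hence `m ≤ ‖μ‖ ‖T‖`. If equality holds, then `‖A ^ n x‖` and
`‖A ^ n X x‖` are comparable to `‖T‖ ^ n` and `m ^ n`. For `S = A / ‖T‖` and for `S = A / m` the
moments `⟪S ^ n y, y⟫` are monotone in `n`; as soon as they are bounded, `S ^ n y` converges to a
fixed vector of `S`. The limits for `y = x` and `y = X x` do not vanish, so `‖T‖` and `m` are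
eigenvalues of `A`.
-/

namespace ExtendedSpectrum

open ContinuousLinearMap Filter Topology
open scoped InnerProductSpace

section Orthogonal

variable {𝕜 E : Type*} [RCLike 𝕜] [NormedAddCommGroup E] [InnerProductSpace 𝕜 E]

lemma orthonormal_inv_norm_smul {ι : Type*} {w : ι → E} (h0 : ∀ i, w i ≠ 0)
    (h : Pairwise fun i j => ⟪w i, w j⟫_𝕜 = 0) :
    Orthonormal 𝕜 fun i => ((‖w i‖⁻¹ : ℝ) : 𝕜) • w i := by
  refine ⟨fun i => ?_, fun i j hij => ?_⟩
  · rw [norm_smul, RCLike.norm_ofReal, abs_inv, abs_norm,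
      inv_mul_cancel₀ (norm_ne_zero_iff.2 (h0 i))]
  · simp only [inner_smul_left, inner_smul_right, h hij, mul_zero]

variable [CompleteSpace E]

lemma summable_of_pairwise_inner_eq_zero {ι : Type*} {g : ι → E}
    (hg : Pairwise fun i j => ⟪g i, g j⟫_𝕜 = 0) (hsum : Summable fun i => ‖g i‖ ^ 2) :
    Summable g := by
  have hV : OrthogonalFamily 𝕜 (fun i => ↥(𝕜 ∙ g i)) fun i => (𝕜 ∙ g i).subtypeₗᵢ :=
    OrthogonalFamily.of_pairwise fun i j hij => by
      simpa [Function.onFun, Submodule.isOrtho_span] using hg hij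
  exact (hV.summable_iff_norm_sq_summable
    fun i => ⟨g i, Submodule.mem_span_singleton_self (g i)⟩).2 hsum

lemma exists_hasSum_inner_smul_of_orthonormal {e g : ℕ → E} {C : ℝ} (he : Orthonormal 𝕜 e)
    (hg : Pairwise fun i j => ⟪g i, g j⟫_𝕜 = 0) (hC : ∀ n, ‖g n‖ ≤ C) :
    ∃ X : E →L[𝕜] E, ∀ x, HasSum (fun n => ⟪e n, x⟫_𝕜 • g n) (X x) := by
  have hsum (x : E) : Summable fun n => ⟪e n, x⟫_𝕜 • g n := by
    refine summable_of_pairwise_inner_eq_zero (𝕜 := 𝕜) (fun i j hij => ?_) ?_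
    · simp only [inner_smul_left, inner_smul_right, hg hij, mul_zero]
    · refine Summable.of_nonneg_of_le (fun n => by positivity) (fun n => ?_)
        ((he.inner_products_summable (x := x)).mul_right (C ^ 2))
      rw [norm_smul, mul_pow]
      gcongr
      exact hC n
  let S (N : ℕ) : E →L[𝕜] E := ∑ n ∈ Finset.range N, (innerSL 𝕜 (e n)).smulRight (g n)
  have hS : Tendsto (fun N x => S N x) atTop (𝓝 fun x => ∑' n, ⟪e n, x⟫_𝕜 • g n) := by
    refine tendsto_pi_nhds.2 fun x => ?_
    simpa only [S, sum_apply, smulRight_apply, innerSL_apply_apply]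
      using (hsum x).hasSum.tendsto_sum_nat
  exact ⟨continuousLinearMapOfTendsto S hS, fun x => (hsum x).hasSum⟩

lemma exists_hasSum_inner_smul {w g : ℕ → E} {C : ℝ} (hw0 : ∀ n, w n ≠ 0)
    (hw : Pairwise fun i j => ⟪w i, w j⟫_𝕜 = 0) (hg : Pairwise fun i j => ⟪g i, g j⟫_𝕜 = 0)
    (hC : ∀ n, ‖w n‖ * ‖g n‖ ≤ C) :
    ∃ X : E →L[𝕜] E, ∀ x, HasSum (fun n => ⟪w n, x⟫_𝕜 • g n) (X x) := by
  obtain ⟨X, hX⟩ := exists_hasSum_inner_smul_of_orthonormal (orthonormal_inv_norm_smul hw0 hw)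
    (g := fun n => (‖w n‖ : 𝕜) • g n) (C := C)
    (fun i j hij => by simp only [inner_smul_left, inner_smul_right, hg hij, mul_zero])
    (fun n => by simpa only [norm_smul, RCLike.norm_ofReal, abs_norm] using hC n)
  refine ⟨X, fun x => (hX x).congr_fun fun n => ?_⟩
  have hn : (‖w n‖ : 𝕜) ≠ 0 := RCLike.ofReal_ne_zero.2 (norm_ne_zero_iff.2 (hw0 n))
  rw [inner_smul_left, RCLike.conj_ofReal, RCLike.ofReal_inv, smul_smul, mul_right_comm,
    inv_mul_cancel₀ hn, one_mul]

end Orthogonal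

lemma le_of_forall_pow_mul_le {a b c K : ℝ} (hb : 0 ≤ b) (hc : 0 < c)
    (h : ∀ n : ℕ, a ^ n * c ≤ b ^ n * K) : a ≤ b := by
  by_contra! hba
  have ha : 0 < a := hb.trans_lt hba
  have hlim : Tendsto (fun n : ℕ => (b / a) ^ n * K) atTop (𝓝 (0 * K)) :=
    (tendsto_pow_atTop_nhds_zero_of_lt_one (div_nonneg hb ha.le)
      ((div_lt_one ha).2 hba)).mul_const K
  refine hc.not_ge ((ge_of_tendsto' hlim fun n => ?_).trans_eq (zero_mul K))
  rw [div_pow, div_mul_eq_mul_div, le_div_iff₀' (pow_pos ha n)]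
  exact h n

section PowerBounds

variable {𝕜 E : Type*} [NontriviallyNormedField 𝕜] [SeminormedAddCommGroup E] [NormedSpace 𝕜 E]
  {S : E →L[𝕜] E} {r : ℝ}

lemma norm_pow_apply_le (hr : 0 ≤ r) {s : Set E} (hs : Set.MapsTo S s s)
    (h : ∀ x ∈ s, ‖S x‖ ≤ r * ‖x‖) (n : ℕ) {x : E} (hx : x ∈ s) : ‖(S ^ n) x‖ ≤ r ^ n * ‖x‖ := by
  induction n generalizing x with
  | zero => rw [pow_zero, pow_zero, one_mul, one_apply_eq_self]
  | succ n ih =>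
    calc ‖(S ^ (n + 1)) x‖ = ‖(S ^ n) (S x)‖ := by rw [pow_succ, mul_apply_eq_comp]
      _ ≤ r ^ n * ‖S x‖ := ih (hs hx)
      _ ≤ r ^ n * (r * ‖x‖) := by gcongr; exact h x hx
      _ = r ^ (n + 1) * ‖x‖ := by ring

lemma norm_pow_apply_le_of_opNorm_le (h : ‖S‖ ≤ r) (n : ℕ) (x : E) :
    ‖(S ^ n) x‖ ≤ r ^ n * ‖x‖ :=
  norm_pow_apply_le ((norm_nonneg S).trans h) (Set.mapsTo_univ S _)
    (fun x _ => S.le_of_opNorm_le h x) n (Set.mem_univ x)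

lemma pow_mul_norm_le_norm_pow_apply (hr : 0 ≤ r) (h : ∀ x, r * ‖x‖ ≤ ‖S x‖) (n : ℕ) (x : E) :
    r ^ n * ‖x‖ ≤ ‖(S ^ n) x‖ := by
  induction n generalizing x with
  | zero => rw [pow_zero, pow_zero, one_mul, one_apply_eq_self]
  | succ n ih =>
    calc r ^ (n + 1) * ‖x‖ = r ^ n * (r * ‖x‖) := by ring
      _ ≤ r ^ n * ‖S x‖ := by gcongr; exact h x
      _ ≤ ‖(S ^ n) (S x)‖ := ih (S x)
      _ = ‖(S ^ (n + 1)) x‖ := by rw [pow_succ, mul_apply_eq_comp]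

end PowerBounds

section PowerConvergence

variable {𝕜 E : Type*} [RCLike 𝕜] [NormedAddCommGroup E] [InnerProductSpace 𝕜 E] [CompleteSpace E]

lemma inner_pow_apply_pow_apply {S : E →L[𝕜] E} (hS : IsSelfAdjoint S) (n k : ℕ) (x : E) :
    ⟪(S ^ n) x, (S ^ k) x⟫_𝕜 = ⟪(S ^ (n + k)) x, x⟫_𝕜 := by
  rw [add_comm, pow_add, mul_apply_eq_comp, ← adjoint_inner_left (S ^ k), ← star_eq_adjoint,
    (hS.pow k).star_eq]

lemma exists_tendsto_pow_apply {S : E →L[𝕜] E} (hS : IsSelfAdjoint S) {x : E} {c : ℝ}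
    (h : Tendsto (fun n => RCLike.re ⟪(S ^ n) x, x⟫_𝕜) atTop (𝓝 c)) :
    ∃ z, S z = z ∧ Tendsto (fun n => (S ^ n) x) atTop (𝓝 z) := by
  have hdist (n k : ℕ) : dist ((S ^ n) x) ((S ^ k) x) =
      √(RCLike.re ⟪(S ^ (n + n)) x, x⟫_𝕜 - 2 * RCLike.re ⟪(S ^ (n + k)) x, x⟫_𝕜 +
        RCLike.re ⟪(S ^ (k + k)) x, x⟫_𝕜) := by
    rw [← inner_pow_apply_pow_apply hS, ← inner_pow_apply_pow_apply hS,
      ← inner_pow_apply_pow_apply hS, inner_self_eq_norm_sq, inner_self_eq_norm_sq,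
      ← norm_sub_sq, Real.sqrt_sq (norm_nonneg _), dist_eq_norm]
  have hcauchy : CauchySeq fun n => (S ^ n) x := by
    rw [cauchySeq_iff_tendsto_dist_atTop_0]
    have h1 : Tendsto Prod.fst (atTop : Filter (ℕ × ℕ)) atTop := by
      rw [← prod_atTop_atTop_eq]; exact tendsto_fst
    have h2 : Tendsto Prod.snd (atTop : Filter (ℕ × ℕ)) atTop := by
      rw [← prod_atTop_atTop_eq]; exact tendsto_snd
    have hlim := (((h.comp (h1.atTop_add_atTop h1)).sub
      ((h.comp (h1.atTop_add_atTop h2)).const_mul 2)).add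
      (h.comp (h2.atTop_add_atTop h2))).sqrt
    rw [show c - 2 * c + c = 0 by ring, Real.sqrt_zero] at hlim
    simpa only [hdist, Function.comp_apply] using hlim
  obtain ⟨z, hz⟩ := cauchySeq_tendsto_of_complete hcauchy
  refine ⟨z, tendsto_nhds_unique ?_ (hz.comp (tendsto_add_atTop_nat 1)), hz⟩
  simpa only [Function.comp_def, pow_succ', mul_apply_eq_comp]
    using (S.continuous.tendsto z).comp hz

end PowerConvergence

section LowerBound

variable {H : Type*} [NormedAddCommGroup H] [InnerProductSpace ℂ H]

lemma lowerBd_nonneg {A : H →L[ℂ] H} (hA : 0 ≤ A) : 0 ≤ lowerBd A := by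
  refine Real.sInf_nonneg ?_
  rintro _ ⟨x, -, rfl⟩
  exact ((nonneg_iff_isPositive A).1 hA).re_inner_nonneg_left x

lemma reApplyInnerSelf_algebraMap (r : ℝ) (x : H) :
    (algebraMap ℝ (H →L[ℂ] H) r).reApplyInnerSelf x = r * ‖x‖ ^ 2 := by
  rw [reApplyInnerSelf_apply, Algebra.algebraMap_eq_smul_one, smul_apply, one_apply_eq_self,
    inner_smul_left_eq_smul, RCLike.smul_re, inner_self_eq_norm_sq]

lemma reApplyInnerSelf_mono {A B : H →L[ℂ] H} (h : A ≤ B) (x : H) :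
    A.reApplyInnerSelf x ≤ B.reApplyInnerSelf x := by
  have hpos := ((ContinuousLinearMap.le_def A B).1 h).re_inner_nonneg_left x
  rwa [sub_apply, inner_sub_left, map_sub, sub_nonneg] at hpos

lemma mul_norm_sq_le_reApplyInnerSelf {A : H →L[ℂ] H} {r : ℝ}
    (h : algebraMap ℝ (H →L[ℂ] H) r ≤ A) (x : H) : r * ‖x‖ ^ 2 ≤ A.reApplyInnerSelf x :=
  (reApplyInnerSelf_algebraMap r x).symm.trans_le (reApplyInnerSelf_mono h x)

lemma le_lowerBd [Nontrivial H] {A : H →L[ℂ] H} {r : ℝ}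
    (h : algebraMap ℝ (H →L[ℂ] H) r ≤ A) : r ≤ lowerBd A := by
  obtain ⟨x, hx⟩ := exists_norm_eq H zero_le_one
  refine le_csInf ⟨_, x, hx, rfl⟩ ?_
  rintro _ ⟨y, hy, rfl⟩
  simpa only [hy.out, one_pow, mul_one] using mul_norm_sq_le_reApplyInnerSelf h y

lemma mul_norm_le_norm_apply {A : H →L[ℂ] H} {r : ℝ} (h : algebraMap ℝ (H →L[ℂ] H) r ≤ A) (x : H) :
    r * ‖x‖ ≤ ‖A x‖ := by
  rcases (norm_nonneg x).eq_or_lt with hx | hx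
  · rw [← hx, mul_zero]
    exact norm_nonneg _
  · refine le_of_mul_le_mul_right ?_ hx
    calc r * ‖x‖ * ‖x‖ = r * ‖x‖ ^ 2 := by ring
      _ ≤ A.reApplyInnerSelf x := mul_norm_sq_le_reApplyInnerSelf h x
      _ ≤ ‖A x‖ * ‖x‖ := re_inner_le_norm (A x) x

variable [CompleteSpace H]

lemma algebraMap_le_of_forall {A : H →L[ℂ] H} (hA : IsSelfAdjoint A) {r : ℝ}
    (h : ∀ x, r * ‖x‖ ^ 2 ≤ A.reApplyInnerSelf x) : algebraMap ℝ (H →L[ℂ] H) r ≤ A := by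
  rw [ContinuousLinearMap.le_def, isPositive_def']
  refine ⟨hA.sub (.algebraMap _ (.all r)), fun x => ?_⟩
  rw [reApplyInnerSelf_apply, sub_apply, inner_sub_left, map_sub, sub_nonneg]
  exact (reApplyInnerSelf_algebraMap r x).trans_le (h x)

lemma algebraMap_lowerBd_le {A : H →L[ℂ] H} (hA : IsSelfAdjoint A) :
    algebraMap ℝ (H →L[ℂ] H) (lowerBd A) ≤ A := by
  have hbdd : BddBelow (A.reApplyInnerSelf '' {x : H | ‖x‖ = 1}) := by
    refine ⟨-‖A‖, ?_⟩
    rintro _ ⟨x, hx, rfl⟩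
    have h : algebraMap ℝ (H →L[ℂ] H) (-‖A‖) ≤ A := by
      rw [map_neg]
      exact hA.neg_algebraMap_norm_le_self
    simpa only [hx.out, one_pow, mul_one] using mul_norm_sq_le_reApplyInnerSelf h x
  refine algebraMap_le_of_forall hA fun x => ?_
  rcases eq_or_ne x 0 with rfl | hx
  · simp [reApplyInnerSelf_apply]
  · have hle : lowerBd A ≤ A.reApplyInnerSelf ((‖x‖⁻¹ : ℂ) • x) :=
      csInf_le hbdd ⟨_, norm_smul_inv_norm hx, rfl⟩
    rwa [reApplyInnerSelf_smul, norm_inv, Complex.norm_real, norm_norm, inv_pow,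
      ← div_eq_inv_mul, le_div_iff₀ (by positivity)] at hle

end LowerBound

section SpectralSubspaces

lemma max_sub_zero_mul_max_sub_zero (s t : ℝ) : max (s - t) 0 * max (t - s) 0 = 0 := by
  rcases le_total s t with h | h
  · rw [max_eq_right (sub_nonpos.2 h), zero_mul]
  · rw [max_eq_right (sub_nonpos.2 h), mul_zero]

lemma max_zero_mul_self (t : ℝ) : max t 0 * max t 0 = max t 0 * t := by
  rcases le_total t 0 with h | h
  · rw [max_eq_right h, zero_mul, zero_mul]
  · rw [max_eq_left h]

variable {H : Type*} [NormedAddCommGroup H] [InnerProductSpace ℂ H]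

lemma apply_of_commute {A B : H →L[ℂ] H} (h : Commute A B) (x : H) : A (B x) = B (A x) :=
  congr($(h.eq) x)

variable [CompleteSpace H]

lemma commute_star_of_isSelfAdjoint {A T : H →L[ℂ] H} (hA : IsSelfAdjoint A) (h : Commute A T) :
    Commute A (star T) := by
  simpa only [hA.star_eq] using h.star_star

lemma reduces_ker {Q T : H →L[ℂ] H} (h : Commute Q T) (h' : Commute Q (star T)) :
    Reduces T (Q.toLinearMap.ker) where
  isClosed := Q.isClosed_ker
  map_mem x (hx : Q x = 0) := show Q (T x) = 0 by rw [apply_of_commute h, hx, map_zero]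
  adjoint_map_mem x (hx : Q x = 0) := show Q (star T x) = 0 by
    rw [apply_of_commute h', hx, map_zero]

/-- The spectral subspace of the self-adjoint operator `A` for `(-∞, r]`, encoded as the kernel of
the positive part of `A - r` since the Borel functional calculus is not available. -/
noncomputable def sublevel (A : H →L[ℂ] H) (r : ℝ) : Submodule ℂ H :=
  (cfc (fun t : ℝ => max (t - r) 0) A).toLinearMap.ker

/-- The spectral subspace of the self-adjoint operator `A` for `[r, ∞)`, encoded as the kernel of
the negative part of `A - r`. -/
noncomputable def superlevel (A : H →L[ℂ] H) (r : ℝ) : Submodule ℂ H :=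
  (cfc (fun t : ℝ => max (r - t) 0) A).toLinearMap.ker

/-- The operator `max(A, r)⁻¹`, which for `0 < r` inverts `A` on `superlevel A r`. -/
noncomputable def truncInv (A : H →L[ℂ] H) (r : ℝ) : H →L[ℂ] H :=
  cfc (fun t : ℝ => (max t r)⁻¹) A

lemma reduces_sublevel {A T : H →L[ℂ] H} (hA : IsSelfAdjoint A) (h : Commute A T) (r : ℝ) :
    Reduces T (sublevel A r) :=
  reduces_ker (h.cfc_real _) ((commute_star_of_isSelfAdjoint hA h).cfc_real _)

lemma reduces_superlevel {A T : H →L[ℂ] H} (hA : IsSelfAdjoint A) (h : Commute A T) (r : ℝ) :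
    Reduces T (superlevel A r) :=
  reduces_ker (h.cfc_real _) ((commute_star_of_isSelfAdjoint hA h).cfc_real _)

lemma ker_cfc_ne_bot {A : H →L[ℂ] H} (hA : IsSelfAdjoint A) {f g : ℝ → ℝ} (hf : Continuous f)
    (hg : Continuous g) (hfg : ∀ t, f t * g t = 0) {t : ℝ} (ht : t ∈ spectrum ℝ A) (hgt : g t ≠ 0) :
    (cfc f A).toLinearMap.ker ≠ ⊥ := by
  intro hker
  have hmul : cfc f A * cfc g A = 0 := by
    rw [← cfc_mul f g A hf.continuousOn hg.continuousOn]
    simp only [hfg, cfc_const_zero]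
  have hzero : cfc g A = cfc (fun _ => (0 : ℝ)) A := by
    rw [cfc_const_zero]
    ext x
    have hx : cfc g A x ∈ (cfc f A).toLinearMap.ker := congr($hmul x)
    rwa [hker, Submodule.mem_bot] at hx
  exact hgt (eqOn_of_cfc_eq_cfc hzero hg.continuousOn continuousOn_const hA ht)

lemma sublevel_ne_bot [Nontrivial H] {A : H →L[ℂ] H} (hA : IsSelfAdjoint A) {r : ℝ}
    (hr : lowerBd A < r) : sublevel A r ≠ ⊥ := by
  obtain ⟨t, ht, htr⟩ : ∃ t ∈ spectrum ℝ A, t < r := by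
    by_contra! h
    exact hr.not_ge (le_lowerBd (algebraMap_le_of_le_spectrum h))
  exact ker_cfc_ne_bot hA (f := fun t => max (t - r) 0) (g := fun t => max (r - t) 0) (by fun_prop)
    (by fun_prop) (fun s => max_sub_zero_mul_max_sub_zero s r) ht
    (lt_max_of_lt_left (sub_pos.2 htr)).ne'

lemma superlevel_ne_bot [Nontrivial H] {A : H →L[ℂ] H} (hA : 0 ≤ A) {r : ℝ}
    (hr : r < ‖A‖) : superlevel A r ≠ ⊥ :=
  ker_cfc_ne_bot hA.isSelfAdjoint (f := fun t => max (r - t) 0) (g := fun t => max (t - r) 0)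
    (by fun_prop) (by fun_prop) (fun s => max_sub_zero_mul_max_sub_zero r s)
    (CStarAlgebra.norm_mem_spectrum_of_nonneg hA) (lt_max_of_lt_left (sub_pos.2 hr)).ne'

lemma cfc_apply_eq_zero {A : H →L[ℂ] H} (hA : IsSelfAdjoint A) {f g : ℝ → ℝ} {r : ℝ}
    (hf : Continuous f) (hg : Continuous g) (hfg : ∀ t, f t * f t = g t * (t - r)) {x : H}
    (hx : A x = (r : ℂ) • x) : cfc f A x = 0 := by
  have hsq : star (cfc f A) * cfc f A = cfc g A * (A - algebraMap ℝ (H →L[ℂ] H) r) := by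
    rw [(cfc_predicate f A : IsSelfAdjoint _).star_eq,
      ← cfc_mul f f A hf.continuousOn hf.continuousOn]
    simp only [hfg]
    rw [cfc_mul g (fun t => t - r) A hg.continuousOn (by fun_prop),
      cfc_sub (fun t => t) (fun _ => r) A, cfc_id' ℝ A, cfc_const r A]
  have hxr : (A - algebraMap ℝ (H →L[ℂ] H) r) x = 0 := by
    rw [sub_apply, hx, Algebra.algebraMap_eq_smul_one, smul_apply, one_apply_eq_self,
      Complex.coe_smul, sub_self]
  rw [← inner_self_eq_zero (𝕜 := ℂ), ← adjoint_inner_left, ← star_eq_adjoint, ← mul_apply_eq_comp,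
    hsq, mul_apply_eq_comp, hxr, map_zero, inner_zero_left]

lemma mem_sublevel_of_apply_eq {A : H →L[ℂ] H} (hA : IsSelfAdjoint A) {r : ℝ} {x : H}
    (hx : A x = (r : ℂ) • x) : x ∈ sublevel A r :=
  cfc_apply_eq_zero hA (f := fun t => max (t - r) 0) (g := fun t => max (t - r) 0)
    (by fun_prop) (by fun_prop) (fun t => max_zero_mul_self (t - r)) hx

lemma mem_superlevel_of_apply_eq {A : H →L[ℂ] H} (hA : IsSelfAdjoint A) {r : ℝ} {x : H}
    (hx : A x = (r : ℂ) • x) : x ∈ superlevel A r :=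
  cfc_apply_eq_zero hA (f := fun t => max (r - t) 0) (g := fun t => -max (r - t) 0)
    (by fun_prop) (by fun_prop)
    (fun t => by rw [max_zero_mul_self, ← neg_sub r t, neg_mul_neg]) hx

lemma norm_apply_le_of_mem_sublevel {A : H →L[ℂ] H} (hA : 0 ≤ A) {r : ℝ} (hr : 0 ≤ r) {x : H}
    (hx : x ∈ sublevel A r) : ‖A x‖ ≤ r * ‖x‖ := by
  have hsplit : A = cfc (fun t : ℝ => max (t - r) 0) A + cfc (fun t : ℝ => min t r) A := by
    rw [← cfc_add A (fun t : ℝ => max (t - r) 0) (fun t => min t r)]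
    conv_lhs => rw [← cfc_id' ℝ A]
    refine cfc_congr fun t _ => ?_
    rw [← sub_self r, max_sub_sub_right, sub_add_eq_add_sub, max_add_min, add_sub_cancel_right]
  have hx' : cfc (fun t : ℝ => max (t - r) 0) A x = 0 := hx
  have hAx : A x = cfc (fun t : ℝ => min t r) A x := by
    conv_lhs => rw [hsplit, add_apply, hx', zero_add]
  rw [hAx]
  refine le_of_opNorm_le _ (norm_cfc_le hr fun t ht => ?_) x
  rw [Real.norm_of_nonneg (le_min (spectrum_nonneg_of_nonneg hA ht) hr)]
  exact min_le_right t r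

lemma apply_truncInv_of_mem_superlevel {A : H →L[ℂ] H} (hA : IsSelfAdjoint A) {r : ℝ} (hr : 0 < r)
    {x : H} (hx : x ∈ superlevel A r) : A (truncInv A r x) = x := by
  have hcont : Continuous fun t : ℝ => (max t r)⁻¹ :=
    (by fun_prop : Continuous fun t : ℝ => max t r).inv₀ fun t => (lt_max_of_lt_right hr).ne'
  have hsum : A * truncInv A r + r⁻¹ • cfc (fun t : ℝ => max (r - t) 0) A = 1 := by
    rw [truncInv, ← cfc_const_mul r⁻¹ (fun t : ℝ => max (r - t) 0) A]
    nth_rw 1 [← cfc_id' ℝ A]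
    rw [← cfc_mul (fun t => t) (fun t => (max t r)⁻¹) A (by fun_prop) hcont.continuousOn,
      ← cfc_add A (fun t => t * (max t r)⁻¹) (fun t => r⁻¹ * max (r - t) 0)
        (continuous_id.mul hcont).continuousOn, ← cfc_const_one ℝ A]
    refine cfc_congr fun t _ => ?_
    rcases le_total t r with h | h
    · rw [max_eq_right h, max_eq_left (sub_nonneg.2 h)]
      field_simp
      ring
    · rw [max_eq_left h, max_eq_right (sub_nonpos.2 h), mul_zero, add_zero,
        mul_inv_cancel₀ (hr.trans_le h).ne']
  have hx' : cfc (fun t : ℝ => max (r - t) 0) A x = 0 := hx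
  simpa only [add_apply, mul_apply_eq_comp, smul_apply, hx', smul_zero, add_zero,
    one_apply_eq_self] using congr($hsum x)

lemma norm_truncInv_le (A : H →L[ℂ] H) {r : ℝ} (hr : 0 < r) : ‖truncInv A r‖ ≤ r⁻¹ :=
  norm_cfc_le (inv_nonneg.2 hr.le) fun t _ => by
    rw [norm_inv, Real.norm_of_nonneg (hr.le.trans (le_max_right t r))]
    exact inv_anti₀ hr (le_max_right t r)

end SpectralSubspaces

section Quasinormal

variable {H : Type*} [NormedAddCommGroup H] [InnerProductSpace ℂ H]

lemma mem_pointSpectrum_iff {A : H →L[ℂ] H} {μ : ℂ} :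
    μ ∈ pointSpectrum A ↔ ∃ x, A x = μ • x ∧ x ≠ 0 := by
  refine ⟨fun h => ?_, fun ⟨x, hx, hx0⟩ => ?_⟩
  · obtain ⟨x, hx⟩ := Module.End.HasEigenvalue.exists_hasEigenvector h
    exact ⟨x, hx.apply_eq_smul, hx.2⟩
  · exact Module.End.hasEigenvalue_of_hasEigenvector ⟨Module.End.mem_eigenspace_iff.2 hx, hx0⟩

variable [CompleteSpace H]

lemma norm_abs_apply (T : H →L[ℂ] H) (x : H) : ‖CFC.abs T x‖ = ‖T x‖ := by
  have hsq (S : H →L[ℂ] H) : ⟪(star S * S) x, x⟫_ℂ = (‖S x‖ : ℂ) ^ 2 := by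
    rw [mul_apply_eq_comp, star_eq_adjoint, adjoint_inner_left]
    exact inner_self_eq_norm_sq_to_K (S x)
  have h := hsq (CFC.abs T)
  rw [(CFC.abs_nonneg T).isSelfAdjoint.star_eq, CFC.abs_mul_abs, hsq] at h
  exact ((sq_eq_sq₀ (norm_nonneg _) (norm_nonneg _)).1 (by exact_mod_cast h)).symm

variable {T : H →L[ℂ] H}

lemma IsQuasinormal.commute_abs (hq : IsQuasinormal T) : Commute (CFC.abs T) T :=
  hq.symm

lemma IsQuasinormal.norm_abs_pow_apply (hq : IsQuasinormal T) (n : ℕ) (x : H) :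
    ‖(CFC.abs T ^ n) x‖ = ‖(T ^ n) x‖ := by
  induction n generalizing x with
  | zero => rfl
  | succ n ih =>
    rw [pow_succ', mul_apply_eq_comp, norm_abs_apply,
      ← apply_of_commute (hq.commute_abs.pow_left n), ih, pow_succ, mul_apply_eq_comp]

lemma IsQuasinormal.adjoint_pow_succ_apply (hq : IsQuasinormal T) (n : ℕ) (x : H) :
    adjoint T ((T ^ (n + 1)) x) = (T ^ n) (CFC.abs T (CFC.abs T x)) := by
  have hcomm : Commute (CFC.abs T * CFC.abs T) (T ^ n) :=
    (hq.commute_abs.mul_left hq.commute_abs).pow_right n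
  rw [pow_succ', ← star_eq_adjoint, ← mul_apply_eq_comp, ← mul_assoc, ← CFC.abs_mul_abs, hcomm.eq]
  rfl

lemma Reduces.isStarNormal_restrict {M : Submodule ℂ H} (hM : Reduces T M) [CompleteSpace M]
    (h : ∀ x ∈ M, T (adjoint T x) = adjoint T (T x)) :
    IsStarNormal (T.restrict (p := M) (q := M) hM.map_mem) := by
  have hadj : star (T.restrict (p := M) (q := M) hM.map_mem) =
      (adjoint T).restrict (p := M) (q := M) hM.adjoint_map_mem := by
    rw [star_eq_adjoint, eq_comm, eq_adjoint_iff]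
    intro x y
    exact adjoint_inner_left T y x
  refine ⟨?_⟩
  rw [hadj]
  ext x
  exact (h x x.2).symm

lemma IsPure.exists_apply_adjoint_ne (hp : IsPure T) {M : Submodule ℂ H} (hM : Reduces T M)
    (hne : M ≠ ⊥) : ∃ x ∈ M, T (adjoint T x) ≠ adjoint T (T x) := by
  by_contra! h
  have : CompleteSpace M := hM.isClosed.completeSpace_coe
  exact hp M hM hne (hM.isStarNormal_restrict h)

/-- Quasinormality says that `T*` annihilates the self-commutator `T T* - T* T`. -/
lemma IsPure.exists_adjoint_eq_zero (hp : IsPure T) (hq : IsQuasinormal T) {M : Submodule ℂ H}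
    (hM : Reduces T M) (hne : M ≠ ⊥) : ∃ u ∈ M, u ≠ 0 ∧ adjoint T u = 0 := by
  obtain ⟨x, hx, hTx⟩ := hp.exists_apply_adjoint_ne hM hne
  refine ⟨T (adjoint T x) - adjoint T (T x), M.sub_mem (hM.map_mem _ (hM.adjoint_map_mem _ hx))
    (hM.adjoint_map_mem _ (hM.map_mem _ hx)), sub_ne_zero.2 hTx, ?_⟩
  have hcomm : Commute (star T * T) (star T) := by
    rw [← CFC.abs_mul_abs]
    have h := commute_star_of_isSelfAdjoint (CFC.abs_nonneg T).isSelfAdjoint hq.commute_abs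
    exact h.mul_left h
  rw [map_sub, sub_eq_zero]
  exact apply_of_commute hcomm x

lemma IsPure.injective (hp : IsPure T) (hq : IsQuasinormal T) : Function.Injective T := by
  have hker (y : H) : CFC.abs T y = 0 ↔ T y = 0 := by
    rw [← norm_eq_zero, norm_abs_apply, norm_eq_zero]
  have hM := reduces_ker hq.commute_abs
    (commute_star_of_isSelfAdjoint (CFC.abs_nonneg T).isSelfAdjoint hq.commute_abs)
  refine (injective_iff_map_eq_zero T).2 fun x hx => ?_
  by_contra hx0
  obtain ⟨y, hy, hTy⟩ := hp.exists_apply_adjoint_ne hM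
    (Submodule.ne_bot_iff _ |>.2 ⟨x, (hker x).2 hx, hx0⟩)
  refine hTy ?_
  rw [(hker y).1 hy, (hker _).1 (hM.adjoint_map_mem y hy), map_zero]

lemma IsPure.norm_pos [Nontrivial H] (hp : IsPure T) (hq : IsQuasinormal T) : 0 < ‖T‖ := by
  obtain ⟨x, hx⟩ := exists_ne (0 : H)
  refine norm_pos_iff.2 fun h => hx (hp.injective hq ?_)
  rw [h, zero_apply, zero_apply]

lemma IsPure.zero_notMem_pointSpectrum_abs (hp : IsPure T) (hq : IsQuasinormal T) :
    (0 : ℂ) ∉ pointSpectrum (CFC.abs T) := by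
  intro h
  obtain ⟨x, hx, hx0⟩ := mem_pointSpectrum_iff.1 h
  refine hx0 (hp.injective hq (norm_eq_zero.1 ?_ |>.trans (map_zero T).symm))
  rw [← norm_abs_apply, hx, zero_smul, norm_zero]

lemma IsPure.zero_notMem_extSpectrum (hp : IsPure T) (hq : IsQuasinormal T) :
    (0 : ℂ) ∉ extSpectrum T := by
  rintro ⟨X, hX0, hX⟩
  refine hX0 (ext fun x => hp.injective hq ?_)
  rw [zero_apply, map_zero, ← mul_apply_eq_comp, hX, zero_smul, zero_apply]

end Quasinormal

section Orbits

variable {H : Type*} [NormedAddCommGroup H] [InnerProductSpace ℂ H] [CompleteSpace H]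
  {T : H →L[ℂ] H}

lemma IsQuasinormal.inner_pow_apply_pow_add_apply (hq : IsQuasinormal T) (i k : ℕ) {x : H}
    (hx : adjoint T x = 0) (y : H) : ⟪(T ^ i) x, (T ^ (i + k + 1)) y⟫_ℂ = 0 := by
  induction i generalizing y with
  | zero =>
    rw [pow_succ', mul_apply_eq_comp, ← adjoint_inner_left, pow_zero, one_apply_eq_self, hx,
      inner_zero_left]
  | succ i ih =>
    rw [pow_succ', mul_apply_eq_comp, ← adjoint_inner_right, hq.adjoint_pow_succ_apply,
      add_right_comm i 1 k]
    exact ih _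

lemma IsQuasinormal.pairwise_inner_pow_apply (hq : IsQuasinormal T) {x : ℕ → H}
    (hx : ∀ n, adjoint T (x n) = 0) :
    Pairwise fun i j => ⟪(T ^ i) (x i), (T ^ j) (x j)⟫_ℂ = 0 := by
  intro i j hij
  rcases lt_or_gt_of_ne hij with h | h
  · obtain ⟨k, rfl⟩ := Nat.exists_eq_add_of_lt h
    exact hq.inner_pow_apply_pow_add_apply i k (hx i) _
  · obtain ⟨k, rfl⟩ := Nat.exists_eq_add_of_lt h
    exact inner_eq_zero_symm.1 (hq.inner_pow_apply_pow_add_apply j k (hx j) _)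

lemma truncInv_pow_apply_mem_superlevel {A : H →L[ℂ] H} (hA : IsSelfAdjoint A) {r : ℝ} (n : ℕ)
    {x : H} (hx : x ∈ superlevel A r) : (truncInv A r ^ n) x ∈ superlevel A r :=
  (reduces_superlevel hA (((Commute.refl A).cfc_real _).symm.pow_right n) r).map_mem x hx

lemma pow_apply_truncInv_pow_apply {A : H →L[ℂ] H} (hA : IsSelfAdjoint A) {r : ℝ} (hr : 0 < r)
    (n : ℕ) {x : H} (hx : x ∈ superlevel A r) : (A ^ n) ((truncInv A r ^ n) x) = x := by
  induction n with
  | zero => rfl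
  | succ n ih =>
    rw [pow_succ, mul_apply_eq_comp, pow_succ', mul_apply_eq_comp,
      apply_truncInv_of_mem_superlevel hA hr (truncInv_pow_apply_mem_superlevel hA n hx), ih]

/-- The sequence `T ^ n |T| ^ (-2 n) v`, a backward orbit of `v` under `T*`: for quasinormal `T`,
`0 < b` and `v` in `superlevel |T| b`, each term is the image under `T*` of the next one. -/
noncomputable def backwardOrbit (T : H →L[ℂ] H) (b : ℝ) (v : H) (n : ℕ) : H :=
  (T ^ n) ((truncInv (CFC.abs T) b ^ (2 * n)) v)

variable {b : ℝ} {v : H}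

lemma IsQuasinormal.adjoint_backwardOrbit_succ (hq : IsQuasinormal T) (hb : 0 < b)
    (hv : v ∈ superlevel (CFC.abs T) b) (n : ℕ) :
    adjoint T (backwardOrbit T b v (n + 1)) = backwardOrbit T b v n := by
  have hA : IsSelfAdjoint (CFC.abs T) := (CFC.abs_nonneg T).isSelfAdjoint
  have hmem (k : ℕ) := truncInv_pow_apply_mem_superlevel hA k hv
  rw [backwardOrbit, hq.adjoint_pow_succ_apply, mul_add_one, pow_succ', mul_apply_eq_comp,
    apply_truncInv_of_mem_superlevel hA hb (hmem _), pow_succ', mul_apply_eq_comp,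
    apply_truncInv_of_mem_superlevel hA hb (hmem _), backwardOrbit]

lemma IsQuasinormal.norm_backwardOrbit_le (hq : IsQuasinormal T) (hb : 0 < b)
    (hv : v ∈ superlevel (CFC.abs T) b) (n : ℕ) : ‖backwardOrbit T b v n‖ ≤ b⁻¹ ^ n * ‖v‖ := by
  have hA : IsSelfAdjoint (CFC.abs T) := (CFC.abs_nonneg T).isSelfAdjoint
  rw [backwardOrbit, ← hq.norm_abs_pow_apply, two_mul, pow_add, mul_apply_eq_comp,
    pow_apply_truncInv_pow_apply hA hb n (truncInv_pow_apply_mem_superlevel hA n hv)]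
  exact norm_pow_apply_le_of_opNorm_le (norm_truncInv_le _ hb) n v

lemma IsQuasinormal.pairwise_inner_backwardOrbit (hq : IsQuasinormal T) (hTv : adjoint T v = 0) :
    Pairwise fun i j => ⟪backwardOrbit T b v i, backwardOrbit T b v j⟫_ℂ = 0 := by
  have hcomm : Commute (truncInv (CFC.abs T) b) (star T) :=
    (commute_star_of_isSelfAdjoint (CFC.abs_nonneg T).isSelfAdjoint hq.commute_abs).cfc_real _
  refine hq.pairwise_inner_pow_apply fun n => ?_
  rw [← star_eq_adjoint, ← apply_of_commute (hcomm.pow_left _), star_eq_adjoint, hTv, map_zero]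

end Orbits

section Construction

variable {H : Type*} [NormedAddCommGroup H] [InnerProductSpace ℂ H] [CompleteSpace H]
  {T : H →L[ℂ] H} {μ : ℂ}

lemma mem_extSpectrum_of_orthogonal {u : H} {w : ℕ → H} {C : ℝ} (hμ : μ ≠ 0) (hu0 : u ≠ 0)
    (hu : Pairwise fun i j => ⟪(T ^ i) u, (T ^ j) u⟫_ℂ = 0) (hw0 : w 0 ≠ 0)
    (hw : Pairwise fun i j => ⟪w i, w j⟫_ℂ = 0) (hTw0 : adjoint T (w 0) = 0)
    (hTw : ∀ n, adjoint T (w (n + 1)) = w n) (hC : ∀ n, ‖w n‖ * ‖(T ^ n) u‖ ≤ C * ‖μ‖ ^ n) :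
    μ ∈ extSpectrum T := by
  have hwn (n : ℕ) : w n ≠ 0 := by
    induction n with
    | zero => exact hw0
    | succ n ih => exact fun h => ih (by rw [← hTw, h, map_zero])
  obtain ⟨X, hX⟩ := exists_hasSum_inner_smul (g := fun n => (μ ^ n)⁻¹ • (T ^ n) u) (C := C) hwn hw
    (fun i j hij => by simp only [inner_smul_left, inner_smul_right, hu hij, mul_zero])
    (fun n => by
      rw [norm_smul, norm_inv, norm_pow, mul_left_comm,
        inv_mul_le_iff₀ (pow_pos (norm_pos_iff.2 hμ) n), mul_comm _ C]
      exact hC n)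
  refine ⟨X, fun h => ?_, ext fun x => ?_⟩
  · have hsingle := hasSum_single (f := fun n => ⟪w n, w 0⟫_ℂ • (μ ^ n)⁻¹ • (T ^ n) u) 0
      fun n hn => by rw [hw hn, zero_smul]
    have hzero := hsingle.unique (hX (w 0))
    simp [h, hw0, hu0] at hzero
  · have hTX := (hX x).mapL T
    have hXT := (hX (T x)).const_smul μ
    rw [← hasSum_nat_add_iff' 1] at hXT
    refine hTX.unique ?_
    convert hXT using 1
    · ext n
      rw [map_smul, map_smul, ← adjoint_inner_left, hTw, ← mul_apply_eq_comp T, ← pow_succ',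
        smul_comm μ, smul_smul μ, pow_succ μ, mul_inv, mul_left_comm, mul_inv_cancel₀ hμ, mul_one]
    · simp [← adjoint_inner_left, hTw0]

lemma mem_extSpectrum_of_level_ne_bot (hp : IsPure T) (hq : IsQuasinormal T) {a b : ℝ} (ha : 0 ≤ a)
    (hb : 0 < b) (hsub : sublevel (CFC.abs T) a ≠ ⊥) (hsup : superlevel (CFC.abs T) b ≠ ⊥)
    (hμ : μ ≠ 0) (hab : a ≤ ‖μ‖ * b) : μ ∈ extSpectrum T := by
  have hA := CFC.abs_nonneg T
  have hsubT := reduces_sublevel hA.isSelfAdjoint hq.commute_abs a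
  have hsubA := reduces_sublevel hA.isSelfAdjoint (Commute.refl (CFC.abs T)) a
  obtain ⟨u, hu, hu0, hTu⟩ := hp.exists_adjoint_eq_zero hq hsubT hsub
  obtain ⟨v, hv, hv0, hTv⟩ := hp.exists_adjoint_eq_zero hq
    (reduces_superlevel hA.isSelfAdjoint hq.commute_abs b) hsup
  refine mem_extSpectrum_of_orthogonal (w := backwardOrbit T b v) (C := ‖v‖ * ‖u‖) hμ hu0
    (hq.pairwise_inner_pow_apply fun _ => hTu) hv0 (hq.pairwise_inner_backwardOrbit hTv) hTv
    (hq.adjoint_backwardOrbit_succ hb hv) fun n => ?_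
  have hnorm_u : ‖(T ^ n) u‖ ≤ a ^ n * ‖u‖ := by
    rw [← hq.norm_abs_pow_apply]
    exact norm_pow_apply_le ha hsubA.map_mem
      (fun x hx => norm_apply_le_of_mem_sublevel hA ha hx) n hu
  calc ‖backwardOrbit T b v n‖ * ‖(T ^ n) u‖
      ≤ (b⁻¹ ^ n * ‖v‖) * (a ^ n * ‖u‖) := by
        gcongr
        exact hq.norm_backwardOrbit_le hb hv n
    _ = ‖v‖ * ‖u‖ * (a / b) ^ n := by rw [div_pow, inv_pow]; ring
    _ ≤ ‖v‖ * ‖u‖ * ‖μ‖ ^ n := by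
        gcongr
        exact (div_le_iff₀ hb).2 hab

lemma mem_extSpectrum_of_div_norm_lt [Nontrivial H] (hp : IsPure T) (hq : IsQuasinormal T)
    (h : lowerBd (CFC.abs T) / ‖T‖ < ‖μ‖) : μ ∈ extSpectrum T := by
  have hT := hp.norm_pos hq
  have hA := CFC.abs_nonneg T
  have hm := lowerBd_nonneg hA
  have hμ : 0 < ‖μ‖ := (div_nonneg hm hT.le).trans_lt h
  obtain ⟨a, hma, ha⟩ := exists_between ((div_lt_iff₀ hT).1 h)
  have ha0 : 0 < a := hm.trans_lt hma
  refine mem_extSpectrum_of_level_ne_bot hp hq ha0.le (div_pos ha0 hμ)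
    (sublevel_ne_bot hA.isSelfAdjoint hma) (superlevel_ne_bot hA ?_) (norm_pos_iff.1 hμ)
    (mul_div_cancel₀ a hμ.ne').ge
  rwa [CFC.norm_abs, div_lt_iff₀' hμ]

lemma mem_extSpectrum_of_mem_pointSpectrum (hp : IsPure T) (hq : IsQuasinormal T) {a b : ℝ}
    (ha : (a : ℂ) ∈ pointSpectrum (CFC.abs T)) (hb : (b : ℂ) ∈ pointSpectrum (CFC.abs T))
    (ha0 : 0 < a) (hb0 : 0 < b) (h : a / b ≤ ‖μ‖) : μ ∈ extSpectrum T := by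
  have hA := (CFC.abs_nonneg T).isSelfAdjoint
  obtain ⟨x, hx, hx0⟩ := mem_pointSpectrum_iff.1 ha
  obtain ⟨y, hy, hy0⟩ := mem_pointSpectrum_iff.1 hb
  exact mem_extSpectrum_of_level_ne_bot hp hq ha0.le hb0
    (Submodule.ne_bot_iff _ |>.2 ⟨x, mem_sublevel_of_apply_eq hA hx, hx0⟩)
    (Submodule.ne_bot_iff _ |>.2 ⟨y, mem_superlevel_of_apply_eq hA hy, hy0⟩)
    (norm_pos_iff.1 ((div_pos ha0 hb0).trans_le h)) ((div_le_iff₀ hb0).1 h)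

end Construction

section FixedVectors

variable {H : Type*} [NormedAddCommGroup H] [InnerProductSpace ℂ H]

lemma norm_inv_smul_pow_apply {A : H →L[ℂ] H} {r : ℝ} (hr : 0 < r) (n : ℕ) (x : H) :
    ‖((r⁻¹ • A) ^ n) x‖ = ‖(A ^ n) x‖ / r ^ n := by
  rw [smul_pow, smul_apply, norm_smul, norm_pow, norm_inv, Real.norm_of_nonneg hr.le, inv_pow,
    div_eq_inv_mul]

lemma mem_pointSpectrum_of_inv_smul {A : H →L[ℂ] H} {r : ℝ} (hr : r ≠ 0)
    (h : ∃ z, (r⁻¹ • A) z = z ∧ z ≠ 0) : (r : ℂ) ∈ pointSpectrum A := by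
  obtain ⟨z, hz, hz0⟩ := h
  refine mem_pointSpectrum_iff.2 ⟨z, ?_, hz0⟩
  rwa [smul_apply, inv_smul_eq_iff₀ hr, ← Complex.coe_smul] at hz

variable [CompleteSpace H]

lemma exists_apply_eq_self_of_tendsto {S : H →L[ℂ] H} (hS : IsSelfAdjoint S) {x : H} {c δ : ℝ}
    (hlim : Tendsto (fun n => (S ^ n).reApplyInnerSelf x) atTop (𝓝 c)) (hδ : 0 < δ)
    (h : ∀ n, δ ≤ ‖(S ^ n) x‖) : ∃ z, S z = z ∧ z ≠ 0 := by
  obtain ⟨z, hz, hxz⟩ := exists_tendsto_pow_apply hS hlim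
  exact ⟨z, hz, norm_pos_iff.1 (hδ.trans_le (ge_of_tendsto' hxz.norm h))⟩

lemma exists_apply_eq_self_of_le_one {S : H →L[ℂ] H} (h0 : 0 ≤ S) (h1 : S ≤ 1) {x : H} {δ : ℝ}
    (hδ : 0 < δ) (h : ∀ n, δ ≤ ‖(S ^ n) x‖) : ∃ z, S z = z ∧ z ≠ 0 := by
  have hanti : Antitone fun n => (S ^ n).reApplyInnerSelf x := fun i j hij =>
    reApplyInnerSelf_mono (CStarAlgebra.pow_antitone h0 h1 hij) x
  have hbdd : BddBelow (Set.range fun n => (S ^ n).reApplyInnerSelf x) := by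
    refine ⟨0, ?_⟩
    rintro _ ⟨n, rfl⟩
    exact ((nonneg_iff_isPositive _).1 (CStarAlgebra.pow_nonneg h0 n)).re_inner_nonneg_left x
  exact exists_apply_eq_self_of_tendsto h0.isSelfAdjoint (tendsto_atTop_ciInf hanti hbdd) hδ h

lemma exists_apply_eq_self_of_one_le {S : H →L[ℂ] H} (h1 : 1 ≤ S) {x : H} (hx : x ≠ 0) {K : ℝ}
    (h : ∀ n, ‖(S ^ n) x‖ ≤ K) : ∃ z, S z = z ∧ z ≠ 0 := by
  have hS : IsSelfAdjoint S := (zero_le_one.trans h1).isSelfAdjoint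
  have hmono : Monotone fun n => (S ^ n).reApplyInnerSelf x := fun i j hij =>
    reApplyInnerSelf_mono (CStarAlgebra.pow_monotone h1 hij) x
  have hbdd : BddAbove (Set.range fun n => (S ^ n).reApplyInnerSelf x) := by
    refine ⟨K * ‖x‖, ?_⟩
    rintro _ ⟨n, rfl⟩
    exact (re_inner_le_norm _ _).trans (by gcongr; exact h n)
  have hexp (y : H) : 1 * ‖y‖ ≤ ‖S y‖ := mul_norm_le_norm_apply (by rwa [map_one]) y
  refine exists_apply_eq_self_of_tendsto hS (tendsto_atTop_ciSup hmono hbdd) (norm_pos_iff.2 hx)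
    fun n => ?_
  simpa only [one_pow, one_mul] using pow_mul_norm_le_norm_pow_apply zero_le_one hexp n x

lemma norm_mem_pointSpectrum {A : H →L[ℂ] H} (hA : 0 ≤ A) (hA0 : 0 < ‖A‖) {x : H} {δ : ℝ}
    (hδ : 0 < δ) (h : ∀ n, δ * ‖A‖ ^ n ≤ ‖(A ^ n) x‖) : (‖A‖ : ℂ) ∈ pointSpectrum A := by
  have hS : 0 ≤ ‖A‖⁻¹ • A := smul_nonneg (inv_nonneg.2 hA0.le) hA
  have hS1 : ‖A‖⁻¹ • A ≤ 1 := by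
    rw [← CStarAlgebra.norm_le_one_iff_of_nonneg _ hS, norm_smul, norm_inv, norm_norm,
      inv_mul_cancel₀ hA0.ne']
  refine mem_pointSpectrum_of_inv_smul hA0.ne'
    (exists_apply_eq_self_of_le_one (x := x) hS hS1 hδ fun n => ?_)
  rw [norm_inv_smul_pow_apply hA0, le_div_iff₀ (pow_pos hA0 n)]
  exact h n

lemma mem_pointSpectrum_of_algebraMap_le {A : H →L[ℂ] H} {r : ℝ} (hr : 0 < r)
    (hA : algebraMap ℝ (H →L[ℂ] H) r ≤ A) {x : H} (hx : x ≠ 0) {K : ℝ}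
    (h : ∀ n, ‖(A ^ n) x‖ ≤ r ^ n * K) : (r : ℂ) ∈ pointSpectrum A := by
  have hS1 : 1 ≤ r⁻¹ • A := by
    have hle := smul_le_smul_of_nonneg_left hA (inv_nonneg.2 hr.le)
    rwa [Algebra.algebraMap_eq_smul_one, inv_smul_smul₀ hr.ne'] at hle
  refine mem_pointSpectrum_of_inv_smul hr.ne'
    (exists_apply_eq_self_of_one_le (K := K) hS1 hx fun n => ?_)
  rw [norm_inv_smul_pow_apply hr, div_le_iff₀' (pow_pos hr n)]
  exact h n

end FixedVectors

section Necessity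

variable {H : Type*} [NormedAddCommGroup H] [InnerProductSpace ℂ H]
  {T X : H →L[ℂ] H} {μ : ℂ}

lemma pow_mul_eq_of_mul_eq (h : T * X = μ • (X * T)) (n : ℕ) :
    T ^ n * X = μ ^ n • (X * T ^ n) := by
  induction n with
  | zero => simp only [pow_zero, one_mul, mul_one, one_smul]
  | succ n ih =>
    rw [pow_succ', mul_assoc, ih, mul_smul_comm, ← mul_assoc, h, smul_mul_assoc, smul_smul,
      mul_assoc, pow_succ]

lemma norm_pow_apply_le_of_mul_eq (h : T * X = μ • (X * T)) (n : ℕ) (x : H) :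
    ‖(T ^ n) (X x)‖ ≤ ‖μ‖ ^ n * (‖X‖ * ‖(T ^ n) x‖) := by
  rw [← mul_apply_eq_comp, pow_mul_eq_of_mul_eq h, smul_apply, norm_smul, norm_pow,
    mul_apply_eq_comp]
  gcongr
  exact X.le_opNorm _

variable [CompleteSpace H]

lemma IsQuasinormal.lowerBd_pow_mul_norm_le (hq : IsQuasinormal T) (n : ℕ) (x : H) :
    lowerBd (CFC.abs T) ^ n * ‖x‖ ≤ ‖(T ^ n) x‖ := by
  have hA := CFC.abs_nonneg T
  rw [← hq.norm_abs_pow_apply]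
  exact pow_mul_norm_le_norm_pow_apply (lowerBd_nonneg hA)
    (mul_norm_le_norm_apply (algebraMap_lowerBd_le hA.isSelfAdjoint)) n x

lemma lowerBd_le_of_mem_extSpectrum (hq : IsQuasinormal T) (hμ : μ ∈ extSpectrum T) :
    lowerBd (CFC.abs T) ≤ ‖μ‖ * ‖T‖ := by
  obtain ⟨X, hX0, hX⟩ := hμ
  obtain ⟨x, hx⟩ := exists_ne_zero hX0
  refine le_of_forall_pow_mul_le (K := ‖X‖ * ‖x‖) (by positivity) (norm_pos_iff.2 hx) fun n => ?_
  calc lowerBd (CFC.abs T) ^ n * ‖X x‖ ≤ ‖(T ^ n) (X x)‖ := hq.lowerBd_pow_mul_norm_le n (X x)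
    _ ≤ ‖μ‖ ^ n * (‖X‖ * ‖(T ^ n) x‖) := norm_pow_apply_le_of_mul_eq hX n x
    _ ≤ ‖μ‖ ^ n * (‖X‖ * (‖T‖ ^ n * ‖x‖)) := by
      gcongr
      exact norm_pow_apply_le_of_opNorm_le le_rfl n x
    _ = (‖μ‖ * ‖T‖) ^ n * (‖X‖ * ‖x‖) := by ring

lemma mem_pointSpectrum_of_mem_extSpectrum (hq : IsQuasinormal T) (hm : 0 < lowerBd (CFC.abs T))
    (hμ : μ ∈ extSpectrum T) (heq : ‖μ‖ * ‖T‖ = lowerBd (CFC.abs T)) :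
    (lowerBd (CFC.abs T) : ℂ) ∈ pointSpectrum (CFC.abs T) ∧
      (‖T‖ : ℂ) ∈ pointSpectrum (CFC.abs T) := by
  have hA := CFC.abs_nonneg T
  have hμT : 0 < ‖μ‖ * ‖T‖ := hm.trans_eq heq.symm
  have hμ0 : 0 < ‖μ‖ := pos_of_mul_pos_left hμT (norm_nonneg T)
  have hT : 0 < ‖T‖ := pos_of_mul_pos_right hμT (norm_nonneg μ)
  obtain ⟨X, hX0, hX⟩ := hμ
  have hXpos : 0 < ‖X‖ := norm_pos_iff.2 hX0
  obtain ⟨x, hx⟩ := exists_ne_zero hX0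
  have hXx : 0 < ‖X x‖ := norm_pos_iff.2 hx
  have hbound := norm_pow_apply_le_of_mul_eq hX (x := x)
  refine ⟨mem_pointSpectrum_of_algebraMap_le (K := ‖X‖ * ‖x‖) hm
    (algebraMap_lowerBd_le hA.isSelfAdjoint) hx fun n => ?_, ?_⟩
  · calc ‖(CFC.abs T ^ n) (X x)‖ = ‖(T ^ n) (X x)‖ := hq.norm_abs_pow_apply n (X x)
      _ ≤ ‖μ‖ ^ n * (‖X‖ * ‖(T ^ n) x‖) := hbound n
      _ ≤ ‖μ‖ ^ n * (‖X‖ * (‖T‖ ^ n * ‖x‖)) := by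
        gcongr
        exact norm_pow_apply_le_of_opNorm_le le_rfl n x
      _ = lowerBd (CFC.abs T) ^ n * (‖X‖ * ‖x‖) := by rw [← heq]; ring
  · rw [← CFC.norm_abs]
    refine norm_mem_pointSpectrum (x := x) hA (by rwa [CFC.norm_abs]) (div_pos hXx hXpos)
      fun n => ?_
    rw [CFC.norm_abs, hq.norm_abs_pow_apply, div_mul_eq_mul_div, div_le_iff₀' hXpos]
    refine le_of_mul_le_mul_left ?_ (pow_pos hμ0 n)
    calc ‖μ‖ ^ n * (‖X x‖ * ‖T‖ ^ n) = lowerBd (CFC.abs T) ^ n * ‖X x‖ := by rw [← heq]; ring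
      _ ≤ ‖(T ^ n) (X x)‖ := hq.lowerBd_pow_mul_norm_le n (X x)
      _ ≤ ‖μ‖ ^ n * (‖X‖ * ‖(T ^ n) x‖) := hbound n

end Necessity

end ExtendedSpectrum

theorem corollary2p5 {H : Type*} [NormedAddCommGroup H] [InnerProductSpace ℂ H]
    [CompleteSpace H] [Nontrivial H] (T : H →L[ℂ] H)
    (hq : ExtendedSpectrum.IsQuasinormal T) (hp : ExtendedSpectrum.IsPure T) :
    ((((ExtendedSpectrum.lowerBd (CFC.abs T) : ℝ) : ℂ) ∈
          ExtendedSpectrum.pointSpectrum (CFC.abs T) ∧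
        ((‖T‖ : ℝ) : ℂ) ∈ ExtendedSpectrum.pointSpectrum (CFC.abs T)) →
      ExtendedSpectrum.extSpectrum T =
        (Metric.ball (0 : ℂ) (ExtendedSpectrum.lowerBd (CFC.abs T) / ‖T‖))ᶜ) ∧
    (¬ (((ExtendedSpectrum.lowerBd (CFC.abs T) : ℝ) : ℂ) ∈
          ExtendedSpectrum.pointSpectrum (CFC.abs T) ∧
        ((‖T‖ : ℝ) : ℂ) ∈ ExtendedSpectrum.pointSpectrum (CFC.abs T)) →
      ExtendedSpectrum.extSpectrum T =
        (Metric.closedBall (0 : ℂ) (ExtendedSpectrum.lowerBd (CFC.abs T) / ‖T‖))ᶜ) := by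
  have hT := hp.norm_pos hq
  have hm := ExtendedSpectrum.lowerBd_nonneg (CFC.abs_nonneg T)
  have hle {μ : ℂ} (hμ : μ ∈ ExtendedSpectrum.extSpectrum T) :=
    (div_le_iff₀ hT).2 (ExtendedSpectrum.lowerBd_le_of_mem_extSpectrum hq hμ)
  refine ⟨fun ⟨hlow, hhigh⟩ => ?_, fun h => ?_⟩
  · ext μ
    rw [Set.mem_compl_iff, mem_ball_zero_iff, not_lt]
    refine ⟨hle, ExtendedSpectrum.mem_extSpectrum_of_mem_pointSpectrum hp hq hlow hhigh
      (hm.lt_of_ne fun h0 => ?_) hT⟩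
    rw [← h0, Complex.ofReal_zero] at hlow
    exact hp.zero_notMem_pointSpectrum_abs hq hlow
  · ext μ
    rw [Set.mem_compl_iff, mem_closedBall_zero_iff, not_le]
    refine ⟨fun hμ => (hle hμ).lt_of_ne fun heq => ?_,
      ExtendedSpectrum.mem_extSpectrum_of_div_norm_lt hp hq⟩
    rcases hm.eq_or_lt with h0 | h0
    · rw [← h0, zero_div, eq_comm, norm_eq_zero] at heq
      exact hp.zero_notMem_extSpectrum hq (heq ▸ hμ)
    · exact h (ExtendedSpectrum.mem_pointSpectrum_of_mem_extSpectrum hq h0 hμ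
        ((div_eq_iff hT.ne').1 heq).symm)
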